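/- Let $G=(V,E)$ be a finite directed graph with edge capacities $c_{ij}\in\mathbb R$ and unit flow costs $f_{ij}\in\mathbb R$ ($(i,j)\in E$), let $S\subseteq V$ be the set of sources (of any size $n$), with unit storage costs $d_i\ge 0$ ($i\in S$), let $T\subseteq V$ be a nonempty set of terminals, and let $h\in\mathbb R$ (the joint entropy of the sources). Let $G^*=(V^*,E^*)$ be $G$ together with a new node $s^*$ and an edge $(s^*,i)$ of infinite capacity for each $i\in S$. For $t\in T$, $i\in V^*$ put $\sigma^{(t)}_i=h$ if $i=s^*$, $-h$ if $i=t$, and $0$ otherwise. Let $\mathcal A$ be the set of the $2^n-1$ nonempty subsets of $S$; $A\in\mathcal A$ stands for the atom $\bigcap_{i\in A}\widetilde X_i\cap\bigcap_{i\in S\setminus A}\widetilde X_i^c$. For real values $\mu=(\mu(A))_{A\in\mathcal A}$, $i,j\in S$ and $U,K\subseteq S$ write $$H_\mu(X_i)=\sum_{A\ni i}\mu(A),\qquad H_\mu(X_U\mid X_{S\setminus U})=\sum_{\emptyset\ne A\subseteq U}\mu(A),\qquad I_\mu(X_i;X_j\mid X_K)=\sum_{A\ni i,j,\ A\cap K=\emptyset}\mu(A),\qquad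 D(\mu)=\sum_{A\in\mathcal A}\Big(\sum_{i\in A}d_i\Big)\mu(A).$$ Consider the following linear programs. * CODED-MIN-COST: minimize $\sum_{(i,j)\in E}f_{ij}z_{ij}+\sum_{i\in S}d_iz_{s^*i}$ over $x^{(t)}_{ij},z_{ij}$ ($(i,j)\in E^*$, $t\in T$) subject to $0\le x^{(t)}_{ij}\le z_{ij}$ on $E^*$, $z_{ij}\le c_{ij}$ on $E$, and $\sum_{j:(i,j)\in E^*}x^{(t)}_{ij}-\sum_{j:(j,i)\in E^*}x^{(t)}_{ji}=\sigma^{(t)}_i$ for all $i\in V^*$, $t\in T$. * ATOM-CODED-MIN-COST: the same objective and constraints, with further variables $R^{(t)}_i$ and $\mu(A)$ of arbitrary sign ($i\in S$, $t\in T$, $A\in\mathcal A$) and further constraints $x^{(t)}_{s^*i}\ge R^{(t)}_i$; $\sum_{i\in U}R^{(t)}_i\ge H_\mu(X_U\mid X_{S\setminus U})$ for all $U\subseteq S$, $t\in T$ (Slepian–Wolf); $z_{s^*i}=H_\mu(X_i)$ for $i\in S$; $\sum_{A\in\mathcal A}\mu(A)=h$; and the elemental inequalities $H_\mu(X_i\mid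 X_{S\setminus\{i\}})\ge0$ ($i\in S$) and $I_\mu(X_i;X_j\mid X_K)\ge0$ ($i\ne j$ in $S$, $K\subseteq S\setminus\{i,j\}$). * SUBSET-MIN-COST: minimize $\sum_{(i,j)\in E}f_{ij}z_{ij}+D(\mu)$ over the same variables and under the same constraints as in ATOM-CODED-MIN-COST, except that the elemental inequalities are replaced by $\mu(A)\ge0$ for all $A\in\mathcal A$. * The gap LP for given atom values $\mu_1$: minimize $D(\mu)-D(\mu_1)$ over $\mu$ subject to $H_\mu(X_U\mid X_{S\setminus U})\le H_{\mu_1}(X_U\mid X_{S\setminus U})$ for all $U\subseteq S$, $\mu(A)\ge0$ for all $A\in\mathcal A$, and $\sum_{A\in\mathcal A}\mu(A)=h$. Then: 1. ATOM-CODED-MIN-COST and CODED-MIN-COST have the same optimal value (which is $+\infty$ if and only if there is no feasible point); if CODED-MIN-COST is feasible, both attain it. 2. Let $(x_1,z_1,R_1,\mu_1)$ be any optimal solution of ATOM-CODED-MIN-COST. The gap LP for $\mu_1$ has an optimal solution. For every feasible $\mu$ of the gap LP, the same flows $x_1$ and rates $R_1$, the values $z_{ij}=(z_1)_{ij}$ on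 $E$ and $z_{s^*i}=H_\mu(X_i)$, and the atom values $\mu$ form a feasible solution of SUBSET-MIN-COST, whose cost exceeds that of $(x_1,z_1,R_1,\mu_1)$ by exactly the value of the gap LP objective at $\mu$. Moreover SUBSET-MIN-COST has an optimal solution, and (optimal value of SUBSET-MIN-COST) $-$ (optimal value of CODED-MIN-COST) $\le$ (optimal value of the gap LP for $\mu_1$). -/

import Mathlib

/-- A minimization problem with real objective over a space of points. -/
structure MinProblem (α : Type*) where
  /-- The set of feasible points. -/
  feasible : Set α
  /-- The objective function. -/
  cost : α → ℝ

namespace MinProblem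

variable {α : Type*}

/-- The optimal value, as an extended real number (it is `⊤` iff the problem is infeasible). -/
noncomputable def value (P : MinProblem α) : EReal :=
  ⨅ p ∈ P.feasible, (P.cost p : EReal)

/-- `p` is an optimal solution: feasible, and of least cost among the feasible points. -/
def IsOptimal (P : MinProblem α) (p : α) : Prop :=
  p ∈ P.feasible ∧ ∀ q ∈ P.feasible, P.cost p ≤ P.cost q

end MinProblem

/-! ### Atoms of the field generated by the sets attached to the sources

The nonempty atom `⋂_{i ∈ A} X̃ᵢ ∩ ⋂_{i ∈ S \ A} X̃ᵢᶜ` of the field generated by the sets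
`X̃ᵢ`, `i ∈ S`, is represented by the nonempty set `A ⊆ S`. A member of the field is represented
by the set of nonempty atoms of which it is the union. -/

section Atoms

variable {V : Type*} [DecidableEq V]

/-- The set `𝒜` of the `2 ^ |S| - 1` nonempty atoms. -/
def atoms (S : Finset V) : Finset (Finset V) := S.powerset.erase ∅

/-- The set `X̃ᵢ`: the union of the atoms `A` in which `X̃ᵢ` occurs uncomplemented. -/
def sourceSet (S : Finset V) (i : V) : Finset (Finset V) := (atoms S).filter (fun A => i ∈ A)

/-- `X̃_U = ⋃_{i ∈ U} X̃ᵢ`. -/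
def unionSet (S U : Finset V) : Finset (Finset V) := U.biUnion (sourceSet S)

/-- The value, on a member `B` of the field, of the signed measure with atom values `μ`. -/
def signedMeas (μ : Finset V → ℝ) (B : Finset (Finset V)) : ℝ := ∑ A ∈ B, μ A

/-- `H(X_U) = μ*(X̃_U)`. -/
def entropy (S : Finset V) (μ : Finset V → ℝ) (U : Finset V) : ℝ :=
  signedMeas μ (unionSet S U)

/-- `H(X_U | X_{S \ U})`: the sum of `μ*(A)` over the atoms `A ⊄ X̃_{S \ U}`. -/
def condEntropy (S : Finset V) (μ : Finset V → ℝ) (U : Finset V) : ℝ :=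
  signedMeas μ (atoms S \ unionSet S (S \ U))

/-- `I(X_i ; X_j | X_K)`: the sum of `μ*(A)` over the atoms `A ⊂ X̃ᵢ`, `A ⊂ X̃ⱼ`, `A ⊄ X̃_K`. -/
def condMutualInfo (S : Finset V) (μ : Finset V → ℝ) (i j : V) (K : Finset V) : ℝ :=
  signedMeas μ ((sourceSet S i ∩ sourceSet S j) \ unionSet S K)

/-- The elemental (Shannon) inequalities. -/
def ElementalInequalities (S : Finset V) (μ : Finset V → ℝ) : Prop :=
  (∀ i ∈ S, 0 ≤ condEntropy S μ {i}) ∧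
  ∀ i ∈ S, ∀ j ∈ S, i ≠ j → ∀ K ⊆ S \ {i, j}, 0 ≤ condMutualInfo S μ i j K

/-- The Slepian-Wolf region of the sources. -/
def slepianWolf (S : Finset V) (μ : Finset V → ℝ) : Set (V → ℝ) :=
  {R | ∀ U ⊆ S, condEntropy S μ U ≤ ∑ i ∈ U, R i}

end Atoms

/-- The data of the content distribution problem on a directed graph with vertex set `V`. -/
structure MulticastInstance (V : Type*) where
  /-- The edges. -/
  E : Finset (V × V)
  /-- The source nodes. -/
  S : Finset V
  /-- The terminals. -/
  T : Finset V
  /-- The edge capacities. -/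
  c : V × V → ℝ
  /-- The cost per unit of flow on an edge. -/
  f : V × V → ℝ
  /-- The cost per unit of information stored at a source node. -/
  d : V → ℝ
  /-- The joint entropy `H(X_1, …, X_n)` of the original source. -/
  h : ℝ

/-- The flow variables: `x t e` is the flow for terminal `t` on the edge `e` of the augmented
graph, `z e` the capacity used on `e`. The vertex `none` is the virtual super node `s*`. -/
structure FlowPoint (V : Type*) where
  /-- `x t (i, j)` is `x_{ij}^{(t)}`. -/
  x : V → Option V × Option V → ℝ
  /-- `z (i, j)` is `z_{ij}`. -/
  z : Option V × Option V → ℝ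

/-- The flow variables together with the rates `R t i` and the atom measures `μ A`. -/
structure AtomFlowPoint (V : Type*) extends FlowPoint V where
  /-- `R t i` is the rate from source `i` to terminal `t`. -/
  R : V → V → ℝ
  /-- `μ A` is the measure `μ*(A)` of the atom `A`. -/
  μ : Finset V → ℝ

namespace MulticastInstance

variable {V : Type*} [DecidableEq V] (N : MulticastInstance V)

/-- The edges of the augmented graph `G*`: those of `G`, and `(s*, i)` for each source `i`. -/
def Estar : Finset (Option V × Option V) :=
  N.E.image (fun e => (some e.1, some e.2)) ∪ N.S.image (fun i => (none, some i))

/-- The capacities of `G*`; those of the virtual edges are infinite. -/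
noncomputable def cstar : Option V × Option V → EReal
  | (some i, some j) => (N.c (i, j) : EReal)
  | _ => ⊤

/-- The net outflow `σ_i^{(t)}` required at the vertex `i` of `G*`. -/
def sigma (t : V) : Option V → ℝ
  | none => N.h
  | some i => if i = t then -N.h else 0

/-- `0 ≤ x ≤ z ≤ c*` on the edges of `G*`, and flow balance at all vertices of `G*`. -/
def FlowConstraints (p : FlowPoint V) : Prop :=
  (∀ t ∈ N.T, ∀ e ∈ N.Estar, 0 ≤ p.x t e ∧ p.x t e ≤ p.z e ∧ (p.z e : EReal) ≤ N.cstar e) ∧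
  ∀ t ∈ N.T, ∀ i : Option V,
    (∑ e ∈ N.Estar.filter (fun e => e.1 = i), p.x t e) -
      (∑ e ∈ N.Estar.filter (fun e => e.2 = i), p.x t e) = N.sigma t i

/-- `∑_{(i,j) ∈ E} f_{ij} z_{ij}`. -/
def edgeCost (p : FlowPoint V) : ℝ := ∑ e ∈ N.E, N.f e * p.z (some e.1, some e.2)

/-- `∑_{i ∈ S} d_i z_{s* i}`. -/
def storageCost (p : FlowPoint V) : ℝ := ∑ i ∈ N.S, N.d i * p.z (none, some i)

/-- `∑_{A ∈ 𝒜} (∑_{i ∈ S, A ⊂ X̃ᵢ} d_i) μ*(A)`. -/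
def atomStorageCost (μ : Finset V → ℝ) : ℝ :=
  ∑ A ∈ atoms N.S, (∑ i ∈ N.S.filter (fun i => A ∈ sourceSet N.S i), N.d i) * μ A

/-- The constraints shared by the coded and the subset problem with atom measures as variables:
network flow, rates supported by the flow and in the Slepian-Wolf region, storage `H(X_i)` at
source `i`, and joint entropy `h`. -/
def AtomConstraints (p : AtomFlowPoint V) : Prop :=
  N.FlowConstraints p.toFlowPoint ∧
  (∀ t ∈ N.T, ∀ i ∈ N.S, p.R t i ≤ p.x t (none, some i)) ∧
  (∀ t ∈ N.T, p.R t ∈ slepianWolf N.S p.μ) ∧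
  (∀ i ∈ N.S, p.z (none, some i) = entropy N.S p.μ {i}) ∧
  N.h = signedMeas p.μ (atoms N.S)

/-- CODED-MIN-COST. -/
def coded : MinProblem (FlowPoint V) where
  feasible := {p | N.FlowConstraints p}
  cost p := N.edgeCost p + N.storageCost p

/-- ATOM-CODED-MIN-COST. -/
def atomCoded : MinProblem (AtomFlowPoint V) where
  feasible := {p | N.AtomConstraints p ∧ ElementalInequalities N.S p.μ}
  cost p := N.edgeCost p.toFlowPoint + N.storageCost p.toFlowPoint

/-- SUBSET-MIN-COST. -/
def subset : MinProblem (AtomFlowPoint V) where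
  feasible := {p | N.AtomConstraints p ∧ ∀ A ∈ atoms N.S, 0 ≤ p.μ A}
  cost p := N.edgeCost p.toFlowPoint + N.atomStorageCost p.μ

/-- The gap LP for given atom values `μ₁`. -/
def gap (μ₁ : Finset V → ℝ) : MinProblem (Finset V → ℝ) where
  feasible := {μ | (∀ U ⊆ N.S, condEntropy N.S μ U ≤ condEntropy N.S μ₁ U) ∧
    (∀ A ∈ atoms N.S, 0 ≤ μ A) ∧ signedMeas μ (atoms N.S) = N.h}
  cost μ := N.atomStorageCost μ - N.atomStorageCost μ₁

/-- Replace the atom values by `μ` and the storage `z_{s* i}` by the resulting `H(X_i)`; all the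
flows, the rates, and `z` on the edges of `G` are kept. -/
def withAtoms (p : AtomFlowPoint V) (μ : Finset V → ℝ) : AtomFlowPoint V where
  x := p.x
  z := fun e => match e with
    | (none, some i) => entropy N.S μ {i}
    | e => p.z e
  R := p.R
  μ := μ

end MulticastInstance

/-!
By Möbius inversion every set function vanishing at `∅` is the entropy function of some atom
values. Given a coded solution, cap the storage `y i` at `h`: the function
`U ↦ min h (∑ i ∈ U, y i)` is monotone and submodular, so its atom values satisfy the elemental
inequalities, and the flow out of `s*`, which has total `h` and is dominated by `y`, lies in their
Slepian-Wolf region. Hence every coded solution extends to atom values at no extra cost.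

For the gap, `D(μ) = ∑ i ∈ S, d i * H_μ(X_i)`, so passing from `μ₁` to `μ` changes the cost by the
gap objective. Since `H(X_i) = h - H(X_{S \ {i}} | X_i)`, smaller conditional entropies mean larger
storage, and the old flows and rates remain feasible. The gap LP is feasible because the elemental
inequalities make every conditional entropy nonnegative: put all the mass `h` on the atom contained
in every `X̃ᵢ`. Optimal solutions exist by compactness, because clamping all the variables of a
solution to bounded intervals keeps it feasible and does not raise its cost.
-/

namespace MinProblem

variable {α β : Type*} {P : MinProblem α} {Q : MinProblem β}

/-- `P` is dominated by `Q` if every feasible point of `P` is matched by a feasible point of `Q` of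
no greater cost; their values are compared through such matchings. -/
def DominatedBy (P : MinProblem α) (Q : MinProblem β) : Prop :=
  ∀ p ∈ P.feasible, ∃ q ∈ Q.feasible, Q.cost q ≤ P.cost p

lemma DominatedBy.value_le (h : P.DominatedBy Q) : Q.value ≤ P.value :=
  le_iInf₂ fun p hp =>
    let ⟨_, hq, hqp⟩ := h p hp
    (iInf₂_le _ hq).trans (EReal.coe_le_coe_iff.2 hqp)

lemma IsOptimal.value_eq {p : α} (hp : P.IsOptimal p) : P.value = P.cost p :=
  le_antisymm (iInf₂_le p hp.1) (le_iInf₂ fun q hq => EReal.coe_le_coe_iff.2 (hp.2 q hq))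

lemma IsOptimal.cost_eq_of_value_eq {p : α} {q : β} (hp : P.IsOptimal p) (hq : Q.IsOptimal q)
    (h : P.value = Q.value) : P.cost p = Q.cost q := by
  rwa [hp.value_eq, hq.value_eq, EReal.coe_eq_coe_iff] at h

lemma DominatedBy.exists_isOptimal_cost_eq (hPQ : P.DominatedBy Q) (hQP : Q.DominatedBy P) {p : α}
    (hp : P.IsOptimal p) : ∃ q, Q.IsOptimal q ∧ P.cost p = Q.cost q := by
  obtain ⟨q, hq, hqp⟩ := hPQ p hp.1
  have hp_le : ∀ r ∈ Q.feasible, P.cost p ≤ Q.cost r := fun r hr =>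
    let ⟨_, hp', hle⟩ := hQP r hr
    (hp.2 _ hp').trans hle
  exact ⟨q, ⟨hq, fun r hr => hqp.trans (hp_le r hr)⟩, (hp_le q hq).antisymm hqp⟩

lemma exists_isOptimal_of_isCompact [TopologicalSpace α] {K : Set α} (hK : IsCompact K)
    (hclosed : IsClosed P.feasible) (hcost : Continuous P.cost)
    (hdom : ∀ p ∈ P.feasible, ∃ q ∈ K ∩ P.feasible, P.cost q ≤ P.cost p)
    (hne : P.feasible.Nonempty) : ∃ p, P.IsOptimal p := by
  obtain ⟨p₀, hp₀⟩ := hne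
  obtain ⟨q₀, hq₀, -⟩ := hdom p₀ hp₀
  obtain ⟨p, hp, hmin⟩ := (hK.inter_right hclosed).exists_isMinOn ⟨q₀, hq₀⟩ hcost.continuousOn
  refine ⟨p, hp.2, fun r hr => ?_⟩
  obtain ⟨q, hq, hqr⟩ := hdom r hr
  exact (hmin hq).trans hqr

end MinProblem

lemma subset_induction_insert {α : Type*} [DecidableEq α] {S : Finset α} {p : Finset α → Prop}
    (top : p S) (step : ∀ W ⊆ S, ∀ j ∈ S, j ∉ W → p (insert j W) → p W)
    {W : Finset α} (hW : W ⊆ S) : p W := by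
  suffices h : ∀ U ⊆ S, p (S \ U) by simpa [Finset.sdiff_sdiff_eq_self hW] using h (S \ W)
  intro U hU
  induction U using Finset.induction_on with
  | empty => simpa using top
  | insert j U hj ih =>
    have hjS : j ∈ S := hU (Finset.mem_insert_self j U)
    refine step _ Finset.sdiff_subset j hjS (by simp) ?_
    rw [Finset.sdiff_insert, Finset.insert_erase (Finset.mem_sdiff.2 ⟨hjS, hj⟩)]
    exact ih ((Finset.subset_insert j U).trans hU)

lemma sum_Iic_sum_Iic_mu_mul {α R : Type*} [Ring R] [PartialOrder α] [OrderBot α]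
    [LocallyFiniteOrder α] [DecidableEq α] (g : α → R) (a : α) :
    ∑ b ∈ Finset.Iic a, ∑ c ∈ Finset.Iic b, IncidenceAlgebra.mu R c b * g c = g a := by
  calc ∑ b ∈ Finset.Iic a, ∑ c ∈ Finset.Iic b, IncidenceAlgebra.mu R c b * g c
      = ∑ c ∈ Finset.Iic a, ∑ b ∈ Finset.Icc c a, IncidenceAlgebra.mu R c b * g c := by
        refine Finset.sum_comm' fun b c => ?_
        simp only [Finset.mem_Iic, Finset.mem_Icc]
        exact ⟨fun h => ⟨⟨h.2, h.1⟩, h.2.trans h.1⟩, fun h => ⟨h.1.2, h.1.1⟩⟩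
    _ = g a := by
        simp [← Finset.sum_mul, IncidenceAlgebra.sum_Icc_mu_right]

lemma min_add_min_add_add_le {M : Type*} [AddCommGroup M] [LinearOrder M] [IsOrderedAddMonoid M]
    {a b : M} (ha : 0 ≤ a) (hb : 0 ≤ b) (h c : M) :
    min h c + min h (a + (b + c)) ≤ min h (a + c) + min h (b + c) := by
  have hca : c ≤ a + c := le_add_of_nonneg_left ha
  have hcb : c ≤ b + c := le_add_of_nonneg_left hb
  rcases le_total h (a + c) with hac | hac
  · rw [min_eq_left hac, add_comm h]
    exact add_le_add (min_le_min_left h hcb) (min_le_left _ _)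
  rcases le_total h (b + c) with hbc | hbc
  · rw [min_eq_left hbc]
    exact add_le_add (min_le_min_left h hca) (min_le_left _ _)
  · rw [min_eq_right hac, min_eq_right hbc]
    calc min h c + min h (a + (b + c)) ≤ c + (a + (b + c)) :=
          add_le_add (min_le_right _ _) (min_le_right _ _)
      _ = a + c + (b + c) := by abel

section Atoms

variable {V : Type*} [DecidableEq V] {S U W : Finset V} {μ ν : Finset V → ℝ}

lemma mem_atoms {A : Finset V} : A ∈ atoms S ↔ A ≠ ∅ ∧ A ⊆ S := by
  simp [atoms]

lemma mem_unionSet {A : Finset V} : A ∈ unionSet S U ↔ A ∈ atoms S ∧ ∃ i ∈ U, i ∈ A := by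
  simp only [unionSet, sourceSet, Finset.mem_biUnion, Finset.mem_filter]
  tauto

lemma unionSet_subset (S U : Finset V) : unionSet S U ⊆ atoms S :=
  fun _ hA => (mem_unionSet.1 hA).1

lemma unionSet_singleton (S : Finset V) (i : V) : unionSet S {i} = sourceSet S i := by
  simp [unionSet]

lemma unionSet_insert (S U : Finset V) (i : V) :
    unionSet S (insert i U) = sourceSet S i ∪ unionSet S U := by
  simp [unionSet]

lemma unionSet_self (S : Finset V) : unionSet S S = atoms S := by
  ext A
  rw [mem_unionSet, and_iff_left_iff_imp, mem_atoms]
  rintro ⟨hne, hA⟩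
  obtain ⟨i, hi⟩ := Finset.nonempty_iff_ne_empty.2 hne
  exact ⟨i, hA hi, hi⟩

lemma atoms_sdiff_unionSet (S U : Finset V) : atoms S \ unionSet S U = atoms (S \ U) := by
  ext A
  simp only [Finset.mem_sdiff, mem_unionSet, mem_atoms, Finset.subset_sdiff,
    Finset.disjoint_right]
  grind

lemma signedMeas_congr (h : ∀ A ∈ atoms S, μ A = ν A) {B : Finset (Finset V)}
    (hB : B ⊆ atoms S) : signedMeas μ B = signedMeas ν B :=
  Finset.sum_congr rfl fun A hA => h A (hB hA)

lemma signedMeas_mono (h : ∀ A ∈ atoms S, 0 ≤ μ A) {B : Finset (Finset V)} (hB : B ⊆ atoms S) :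
    signedMeas μ B ≤ signedMeas μ (atoms S) :=
  Finset.sum_le_sum_of_subset_of_nonneg hB fun A hA _ => h A hA

lemma le_signedMeas_atoms (h : ∀ A ∈ atoms S, 0 ≤ μ A) {A : Finset V} (hA : A ∈ atoms S) :
    μ A ≤ signedMeas μ (atoms S) :=
  Finset.single_le_sum (f := μ) h hA

lemma entropy_self (S : Finset V) (μ : Finset V → ℝ) : entropy S μ S = signedMeas μ (atoms S) := by
  rw [entropy, unionSet_self]

lemma signedMeas_atoms_sdiff (S U : Finset V) (μ : Finset V → ℝ) :
    signedMeas μ (atoms (S \ U)) = entropy S μ S - entropy S μ U := by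
  rw [← atoms_sdiff_unionSet, entropy_self, entropy, eq_sub_iff_add_eq]
  exact Finset.sum_sdiff (unionSet_subset S U)

lemma condEntropy_eq_sub (S U : Finset V) (μ : Finset V → ℝ) :
    condEntropy S μ U = entropy S μ S - entropy S μ (S \ U) := by
  rw [condEntropy, atoms_sdiff_unionSet, signedMeas_atoms_sdiff]

lemma condEntropy_eq_signedMeas_atoms (μ : Finset V → ℝ) (hU : U ⊆ S) :
    condEntropy S μ U = signedMeas μ (atoms U) := by
  rw [condEntropy, atoms_sdiff_unionSet, Finset.sdiff_sdiff_eq_self hU]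

lemma condMutualInfo_eq (S K : Finset V) (μ : Finset V → ℝ) (i j : V) :
    condMutualInfo S μ i j K = entropy S μ (insert i K) + entropy S μ (insert j K) -
      (entropy S μ K + entropy S μ (insert i (insert j K))) := by
  simp only [condMutualInfo, entropy, unionSet_insert]
  generalize sourceSet S i = a, sourceSet S j = b, unionSet S K = k
  have hmodular : signedMeas μ (a ∪ (b ∪ k)) + signedMeas μ (a ∩ b ∪ k) =
      signedMeas μ (a ∪ k) + signedMeas μ (b ∪ k) := by
    rw [← Finset.union_assoc, Finset.union_union_distrib_right, Finset.inter_union_distrib_right]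
    exact Finset.sum_union_inter
  have hsdiff : signedMeas μ (a ∩ b ∪ k) = signedMeas μ ((a ∩ b) \ k) + signedMeas μ k := by
    rw [← Finset.sdiff_union_self_eq_union]
    exact Finset.sum_union Finset.sdiff_disjoint
  linarith

lemma exists_forall_entropy_eq (S : Finset V) {g : Finset V → ℝ} (hg : g ∅ = 0) :
    ∃ μ, ∀ U ⊆ S, entropy S μ U = g U := by
  let F : Finset V → ℝ := fun U => g S - g (S \ U)
  let μ : Finset V → ℝ := fun A => ∑ B ∈ Finset.Iic A, IncidenceAlgebra.mu ℝ B A * F B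
  have hμ_empty : μ ∅ = 0 := by simp [μ, F, Finset.Iic_eq_powerset]
  have hμ (U : Finset V) : signedMeas μ (atoms U) = F U := by
    rw [← sum_Iic_sum_Iic_mu_mul F U, Finset.Iic_eq_powerset]
    exact Finset.sum_erase _ hμ_empty
  refine ⟨μ, fun U hU => ?_⟩
  have h := signedMeas_atoms_sdiff S U μ
  rw [entropy_self, hμ, hμ] at h
  simp only [F, Finset.sdiff_sdiff_eq_self hU, Finset.sdiff_self, hg] at h
  linarith

lemma entropy_le_of_condEntropy_le {i : V} (hi : i ∈ S)
    (hsum : signedMeas μ (atoms S) = signedMeas ν (atoms S))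
    (h : condEntropy S μ (S.erase i) ≤ condEntropy S ν (S.erase i)) :
    entropy S ν {i} ≤ entropy S μ {i} := by
  rw [condEntropy_eq_sub, condEntropy_eq_sub, Finset.sdiff_erase_self hi, entropy_self,
    entropy_self, hsum] at h
  linarith

lemma ElementalInequalities.entropy_le_entropy_insert (hμ : ElementalInequalities S μ) {i : V}
    (hi : i ∈ S) (hW : W ⊆ S.erase i) : entropy S μ W ≤ entropy S μ (insert i W) := by
  refine subset_induction_insert (p := fun W => entropy S μ W ≤ entropy S μ (insert i W)) ?_
    (fun W hW j hj hjW ih => ?_) hW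
  · have h := hμ.1 i hi
    rw [condEntropy_eq_sub, Finset.sdiff_singleton_eq_erase] at h
    rw [Finset.insert_erase hi]
    linarith
  · have hWij : W ⊆ S \ {i, j} := by
      intro k hk
      have := hW hk
      grind
    have h := hμ.2 i hi j (Finset.mem_of_mem_erase hj) (Finset.ne_of_mem_erase hj).symm W hWij
    rw [condMutualInfo_eq] at h
    linarith

lemma ElementalInequalities.entropy_le_entropy_self (hμ : ElementalInequalities S μ)
    (hW : W ⊆ S) : entropy S μ W ≤ entropy S μ S :=
  subset_induction_insert (p := fun W => entropy S μ W ≤ entropy S μ S) le_rfl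
    (fun _ hW _ hj hjW ih =>
      (hμ.entropy_le_entropy_insert hj (Finset.subset_erase.2 ⟨hW, hjW⟩)).trans ih) hW

lemma ElementalInequalities.condEntropy_nonneg (hμ : ElementalInequalities S μ) (U : Finset V) :
    0 ≤ condEntropy S μ U := by
  rw [condEntropy_eq_sub]
  exact sub_nonneg.2 (hμ.entropy_le_entropy_self Finset.sdiff_subset)

lemma signedMeas_single (h : ℝ) (A : Finset V) (B : Finset (Finset V)) :
    signedMeas (Pi.single A h) B = if A ∈ B then h else 0 :=
  Finset.sum_pi_single' A h B

section TruncatedSum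

variable {h : ℝ} {x y : V → ℝ}

lemma elementalInequalities_of_entropy_eq_min (hμ : ∀ U ⊆ S, entropy S μ U = min h (∑ i ∈ U, y i))
    (hy : ∀ i ∈ S, 0 ≤ y i) (hS : h ≤ ∑ i ∈ S, y i) : ElementalInequalities S μ := by
  refine ⟨fun i _ => ?_, fun i hi j hj hij K hK => ?_⟩
  · rw [condEntropy_eq_sub, hμ S subset_rfl, hμ _ Finset.sdiff_subset, min_eq_left hS]
    exact sub_nonneg.2 (min_le_left _ _)
  · obtain ⟨hKS, hdisj⟩ := Finset.subset_sdiff.1 hK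
    have hiK : i ∉ K := Finset.disjoint_right.1 hdisj (by simp)
    have hjK : j ∉ K := Finset.disjoint_right.1 hdisj (by simp)
    have hjKS : insert j K ⊆ S := Finset.insert_subset hj hKS
    have hi_jK : i ∉ insert j K := by simp [hij, hiK]
    rw [condMutualInfo_eq, hμ K hKS, hμ _ hjKS, hμ _ (Finset.insert_subset hi hKS),
      hμ _ (Finset.insert_subset hi hjKS), Finset.sum_insert hi_jK,
      Finset.sum_insert hiK, Finset.sum_insert hjK]
    exact sub_nonneg.2 (min_add_min_add_add_le (hy i hi) (hy j hj) _ _)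

lemma mem_slepianWolf_of_entropy_eq_min
    (hμ : ∀ U ⊆ S, entropy S μ U = min h (∑ i ∈ U, y i)) (hx : ∀ i ∈ S, 0 ≤ x i)
    (hxy : ∀ i ∈ S, x i ≤ y i) (hsum : ∑ i ∈ S, x i = h) : x ∈ slepianWolf S μ := by
  intro U hU
  have hcompl : ∑ i ∈ S \ U, x i = h - ∑ i ∈ U, x i := by
    rw [eq_sub_iff_add_eq, Finset.sum_sdiff hU, hsum]
  have hle_entropy : ∑ i ∈ S \ U, x i ≤ entropy S μ (S \ U) := by
    rw [hμ _ Finset.sdiff_subset, hcompl]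
    refine le_min (sub_le_self h (Finset.sum_nonneg fun i hi => hx i (hU hi))) ?_
    rw [← hcompl]
    exact Finset.sum_le_sum fun i hi => hxy i (Finset.mem_sdiff.1 hi).1
  have hentropy_le : entropy S μ S ≤ h := (hμ S subset_rfl).trans_le (min_le_left _ _)
  rw [condEntropy_eq_sub]
  linarith

end TruncatedSum

end Atoms

section Clamp

variable {a b c : ℝ}

/-- The point of `[0, |b|]` closest to `a`; the interval is never empty, and it is `[0, b]` in all
the cases where the solutions of the linear programs are truncated. -/
noncomputable def clampAbs (b a : ℝ) : ℝ := Set.projIcc 0 |b| (abs_nonneg b) a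

lemma clampAbs_mem_Icc (b a : ℝ) : clampAbs b a ∈ Set.Icc 0 |b| :=
  Subtype.coe_prop _

lemma clampAbs_eq_self (ha : 0 ≤ a) (hab : a ≤ b) : clampAbs b a = a :=
  congrArg Subtype.val (Set.projIcc_of_mem _ ⟨ha, hab.trans (le_abs_self b)⟩)

lemma clampAbs_le_self (ha : 0 ≤ a) : clampAbs b a ≤ a :=
  max_le ha (min_le_right _ _)

lemma le_clampAbs (hab : a ≤ b) : a ≤ clampAbs b a :=
  le_max_of_le_right (le_min (hab.trans (le_abs_self b)) le_rfl)

lemma clampAbs_le_clampAbs (b : ℝ) (h : a ≤ c) : clampAbs b a ≤ clampAbs b c :=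
  Set.monotone_projIcc _ h

end Clamp

@[fun_prop]
lemma continuous_signedMeas {V : Type*} (B : Finset (Finset V)) :
    Continuous fun μ : Finset V → ℝ => signedMeas μ B := by
  unfold signedMeas
  fun_prop

namespace FlowPoint

variable {V : Type*}

/-- The topology of pointwise convergence of the variables. -/
instance : TopologicalSpace (FlowPoint V) :=
  .induced (fun p => (p.x, p.z)) inferInstance

lemma isInducing_prodMk : Topology.IsInducing fun p : FlowPoint V => (p.x, p.z) := ⟨rfl⟩

@[fun_prop]
lemma continuous_x : Continuous fun p : FlowPoint V => p.x :=
  continuous_fst.comp isInducing_prodMk.continuous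

@[fun_prop]
lemma continuous_z : Continuous fun p : FlowPoint V => p.z :=
  continuous_snd.comp isInducing_prodMk.continuous

/-- The flow variables whose values at `e` lie in `[0, |b e|]`. -/
def box (b : Option V × Option V → ℝ) : Set (FlowPoint V) :=
  {p | (∀ t e, p.x t e ∈ Set.Icc 0 |b e|) ∧ ∀ e, p.z e ∈ Set.Icc 0 |b e|}

lemma isCompact_box (b : Option V × Option V → ℝ) : IsCompact (box b) := by
  convert isInducing_prodMk.isCompact_preimage' (K :=
    (Set.univ.pi fun _ => Set.univ.pi fun e => Set.Icc 0 |b e|) ×ˢ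
      Set.univ.pi fun e => Set.Icc 0 |b e|)
    ((isCompact_univ_pi fun _ => isCompact_univ_pi fun _ => isCompact_Icc).prod
      (isCompact_univ_pi fun _ => isCompact_Icc)) (fun k _ => ⟨⟨k.1, k.2⟩, rfl⟩)
  ext p
  simp only [box, Set.mem_ofPred_eq, Set.mem_preimage, Set.mem_prod, Set.mem_univ_pi]

/-- Move every value at `e` into `[0, |b e|]`. -/
noncomputable def clamp (b : Option V × Option V → ℝ) (p : FlowPoint V) : FlowPoint V where
  x t e := clampAbs (b e) (p.x t e)
  z e := clampAbs (b e) (p.z e)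

lemma clamp_mem_box (b : Option V × Option V → ℝ) (p : FlowPoint V) : p.clamp b ∈ box b :=
  ⟨fun _ _ => clampAbs_mem_Icc _ _, fun _ => clampAbs_mem_Icc _ _⟩

end FlowPoint

namespace AtomFlowPoint

variable {V : Type*}

/-- The topology of pointwise convergence of the variables. -/
instance : TopologicalSpace (AtomFlowPoint V) :=
  .induced (fun p => (p.toFlowPoint, p.R, p.μ)) inferInstance

lemma isInducing_prodMk :
    Topology.IsInducing fun p : AtomFlowPoint V => (p.toFlowPoint, p.R, p.μ) := ⟨rfl⟩

@[fun_prop]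
lemma continuous_toFlowPoint : Continuous fun p : AtomFlowPoint V => p.toFlowPoint :=
  continuous_fst.comp isInducing_prodMk.continuous

@[fun_prop]
lemma continuous_R : Continuous fun p : AtomFlowPoint V => p.R :=
  continuous_fst.comp (continuous_snd.comp isInducing_prodMk.continuous)

@[fun_prop]
lemma continuous_μ : Continuous fun p : AtomFlowPoint V => p.μ :=
  continuous_snd.comp (continuous_snd.comp isInducing_prodMk.continuous)

/-- The points whose flow variables at `e` lie in `[0, |b e|]`, and whose rates and atom values lie
in `[0, |h|]`. -/
def box (b : Option V × Option V → ℝ) (h : ℝ) : Set (AtomFlowPoint V) :=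
  {p | p.toFlowPoint ∈ FlowPoint.box b ∧ (∀ t i, p.R t i ∈ Set.Icc 0 |h|) ∧
    ∀ A, p.μ A ∈ Set.Icc 0 |h|}

lemma isCompact_box (b : Option V × Option V → ℝ) (h : ℝ) : IsCompact (box b h) := by
  convert isInducing_prodMk.isCompact_preimage' (K :=
    FlowPoint.box b ×ˢ (Set.univ.pi fun _ => Set.univ.pi fun _ => Set.Icc 0 |h|) ×ˢ
      Set.univ.pi fun _ => Set.Icc 0 |h|)
    ((FlowPoint.isCompact_box b).prod
      ((isCompact_univ_pi fun _ => isCompact_univ_pi fun _ => isCompact_Icc).prod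
        (isCompact_univ_pi fun _ => isCompact_Icc))) (fun k _ => ⟨⟨k.1, k.2.1, k.2.2⟩, rfl⟩)
  ext p
  simp only [box, Set.mem_ofPred_eq, Set.mem_preimage, Set.mem_prod, Set.mem_univ_pi]

/-- Move the flow variables at `e` into `[0, |b e|]`, and the rates and atom values into
`[0, |h|]`. -/
noncomputable def clamp (b : Option V × Option V → ℝ) (h : ℝ) (p : AtomFlowPoint V) :
    AtomFlowPoint V where
  toFlowPoint := p.toFlowPoint.clamp b
  R t i := clampAbs h (p.R t i)
  μ A := clampAbs h (p.μ A)

lemma clamp_mem_box (b : Option V × Option V → ℝ) (h : ℝ) (p : AtomFlowPoint V) :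
    p.clamp b h ∈ box b h :=
  ⟨p.toFlowPoint.clamp_mem_box b, fun _ _ => clampAbs_mem_Icc _ _, fun _ => clampAbs_mem_Icc _ _⟩

end AtomFlowPoint

namespace MulticastInstance

/-- An upper bound for the flow on each edge of `G*`: the capacity on the edges of `G`, and `h` on
the virtual edges. -/
def edgeBound {V : Type*} (N : MulticastInstance V) : Option V × Option V → ℝ
  | (some i, some j) => N.c (i, j)
  | _ => N.h

variable {V : Type*} [DecidableEq V] {N : MulticastInstance V} {p q : FlowPoint V}
  {μ μ₁ : Finset V → ℝ}

lemma some_mem_Estar {i j : V} : (some i, some j) ∈ N.Estar ↔ (i, j) ∈ N.E := by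
  simp [Estar]

lemma none_mem_Estar {i : V} : (none, some i) ∈ N.Estar ↔ i ∈ N.S := by
  simp [Estar]

lemma notMem_Estar_none (o : Option V) : (o, none) ∉ N.Estar := by
  simp [Estar]

lemma forall_mem_Estar {P : Option V × Option V → Prop} :
    (∀ e ∈ N.Estar, P e) ↔
      (∀ e ∈ N.E, P (some e.1, some e.2)) ∧ ∀ i ∈ N.S, P (none, some i) := by
  simp only [Estar, Finset.forall_mem_union, Finset.forall_mem_image]

namespace FlowConstraints

lemma x_nonneg (hp : N.FlowConstraints p) {t : V} (ht : t ∈ N.T) {e : Option V × Option V}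
    (he : e ∈ N.Estar) : 0 ≤ p.x t e :=
  (hp.1 t ht e he).1

lemma x_le_z (hp : N.FlowConstraints p) {t : V} (ht : t ∈ N.T) {e : Option V × Option V}
    (he : e ∈ N.Estar) : p.x t e ≤ p.z e :=
  (hp.1 t ht e he).2.1

lemma z_nonneg (hp : N.FlowConstraints p) (hT : N.T.Nonempty) {e : Option V × Option V}
    (he : e ∈ N.Estar) : 0 ≤ p.z e :=
  let ⟨_, ht⟩ := hT
  (hp.x_nonneg ht he).trans (hp.x_le_z ht he)

lemma z_le_c (hp : N.FlowConstraints p) (hT : N.T.Nonempty) {e : V × V} (he : e ∈ N.E) :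
    p.z (some e.1, some e.2) ≤ N.c e :=
  let ⟨t, ht⟩ := hT
  EReal.coe_le_coe_iff.1 (hp.1 t ht _ (some_mem_Estar.2 he)).2.2

lemma sum_source (hp : N.FlowConstraints p) {t : V} (ht : t ∈ N.T) :
    ∑ i ∈ N.S, p.x t (none, some i) = N.h := by
  have hout : N.Estar.filter (fun e => e.1 = none) = N.S.image (fun i => (none, some i)) := by
    ext ⟨a, b⟩
    simp only [Estar, Finset.mem_filter, Finset.mem_union, Finset.mem_image, Prod.mk.injEq]
    grind
  have hin : N.Estar.filter (fun e => e.2 = none) = ∅ := by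
    rw [Finset.filter_eq_empty_iff]
    rintro ⟨a, b⟩ he rfl
    exact notMem_Estar_none a he
  have hbalance := hp.2 t ht none
  rwa [hout, hin, Finset.sum_image (by simp), Finset.sum_empty, sub_zero] at hbalance

lemma source_le (hp : N.FlowConstraints p) {t : V} (ht : t ∈ N.T) {i : V} (hi : i ∈ N.S) :
    p.x t (none, some i) ≤ N.h := by
  rw [← hp.sum_source ht]
  exact Finset.single_le_sum (f := fun i => p.x t (none, some i))
    (fun j hj => hp.x_nonneg ht (none_mem_Estar.2 hj)) hi

lemma h_nonneg (hp : N.FlowConstraints p) (hT : N.T.Nonempty) : 0 ≤ N.h := by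
  obtain ⟨t, ht⟩ := hT
  rw [← hp.sum_source ht]
  exact Finset.sum_nonneg fun i hi => hp.x_nonneg ht (none_mem_Estar.2 hi)

lemma x_le_edgeBound (hp : N.FlowConstraints p) {t : V} (ht : t ∈ N.T) :
    ∀ e ∈ N.Estar, p.x t e ≤ N.edgeBound e :=
  forall_mem_Estar.2 ⟨fun _ he =>
    (hp.x_le_z ht (some_mem_Estar.2 he)).trans (hp.z_le_c ⟨t, ht⟩ he), fun _ => hp.source_le ht⟩

lemma of_eqOn (hp : N.FlowConstraints p) (hx : ∀ t ∈ N.T, ∀ e ∈ N.Estar, q.x t e = p.x t e)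
    (hz : ∀ e ∈ N.E, q.z (some e.1, some e.2) = p.z (some e.1, some e.2))
    (hs : ∀ t ∈ N.T, ∀ i ∈ N.S, p.x t (none, some i) ≤ q.z (none, some i)) :
    N.FlowConstraints q := by
  refine ⟨fun t ht => forall_mem_Estar.2 ⟨fun e he => ?_, fun i hi => ?_⟩, fun t ht i => ?_⟩
  · have he' := some_mem_Estar.2 he
    rw [hx t ht _ he', hz e he]
    exact hp.1 t ht _ he'
  · have hi' := none_mem_Estar.2 hi
    rw [hx t ht _ hi']
    exact ⟨hp.x_nonneg ht hi', hs t ht i hi, le_top⟩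
  · rw [← hp.2 t ht i]
    congr 1 <;> exact Finset.sum_congr rfl fun e he => hx t ht e (Finset.mem_filter.1 he).1

lemma clamp_x (hp : N.FlowConstraints p) {t : V} (ht : t ∈ N.T) {e : Option V × Option V}
    (he : e ∈ N.Estar) : (p.clamp N.edgeBound).x t e = p.x t e :=
  clampAbs_eq_self (hp.x_nonneg ht he) (hp.x_le_edgeBound ht e he)

lemma clamp_z (hp : N.FlowConstraints p) (hT : N.T.Nonempty) {e : V × V} (he : e ∈ N.E) :
    (p.clamp N.edgeBound).z (some e.1, some e.2) = p.z (some e.1, some e.2) :=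
  clampAbs_eq_self (hp.z_nonneg hT (some_mem_Estar.2 he)) (hp.z_le_c hT he)

lemma clamp (hp : N.FlowConstraints p) (hT : N.T.Nonempty) :
    N.FlowConstraints (p.clamp N.edgeBound) := by
  refine hp.of_eqOn (fun t ht e he => hp.clamp_x ht he) (fun e he => hp.clamp_z hT he)
    fun t ht i hi => ?_
  have hi' := none_mem_Estar.2 hi
  rw [← hp.clamp_x ht hi']
  exact clampAbs_le_clampAbs _ (hp.x_le_z ht hi')

lemma edgeCost_clamp (hp : N.FlowConstraints p) (hT : N.T.Nonempty) :
    N.edgeCost (p.clamp N.edgeBound) = N.edgeCost p :=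
  Finset.sum_congr rfl fun e he => by rw [hp.clamp_z hT he]

lemma coded_cost_clamp_le (hp : N.FlowConstraints p) (hT : N.T.Nonempty)
    (hd : ∀ i ∈ N.S, 0 ≤ N.d i) : N.coded.cost (p.clamp N.edgeBound) ≤ N.coded.cost p :=
  add_le_add (hp.edgeCost_clamp hT).le <| Finset.sum_le_sum fun i hi =>
    mul_le_mul_of_nonneg_left (clampAbs_le_self (hp.z_nonneg hT (none_mem_Estar.2 hi))) (hd i hi)

end FlowConstraints

variable (N) in
lemma isClosed_flowConstraints : IsClosed {p | N.FlowConstraints p} := by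
  simp only [FlowConstraints, Set.ofPred_and, Set.ofPred_forall]
  refine .inter (isClosed_iInter fun t => isClosed_iInter fun _ => isClosed_iInter fun e =>
    isClosed_iInter fun _ => .inter ?_ (.inter ?_ ?_))
    (isClosed_iInter fun t => isClosed_iInter fun _ => isClosed_iInter fun i => ?_)
  · exact isClosed_le (by fun_prop) (by fun_prop)
  · exact isClosed_le (by fun_prop) (by fun_prop)
  · exact isClosed_le (continuous_coe_real_ereal.comp (by fun_prop)) (by fun_prop)
  · exact isClosed_eq (by fun_prop) (by fun_prop)

lemma exists_isOptimal_coded (hT : N.T.Nonempty) (hd : ∀ i ∈ N.S, 0 ≤ N.d i)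
    (hne : N.coded.feasible.Nonempty) : ∃ p, N.coded.IsOptimal p := by
  refine MinProblem.exists_isOptimal_of_isCompact (FlowPoint.isCompact_box N.edgeBound)
    N.isClosed_flowConstraints ?_ (fun p hp => ⟨p.clamp N.edgeBound,
      ⟨p.clamp_mem_box _, hp.clamp hT⟩, hp.coded_cost_clamp_le hT hd⟩) hne
  simp only [coded, edgeCost, storageCost]
  fun_prop

lemma FlowConstraints.exists_mem_atomCoded_feasible (hp : N.FlowConstraints p) (hT : N.T.Nonempty)
    (hz : ∀ i ∈ N.S, p.z (none, some i) ≤ N.h) :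
    ∃ q ∈ N.atomCoded.feasible, q.toFlowPoint = p := by
  let y : V → ℝ := fun i => p.z (none, some i)
  have hy : ∀ i ∈ N.S, 0 ≤ y i := fun i hi => hp.z_nonneg hT (none_mem_Estar.2 hi)
  have hxy : ∀ t ∈ N.T, ∀ i ∈ N.S, p.x t (none, some i) ≤ y i := fun t ht i hi =>
    hp.x_le_z ht (none_mem_Estar.2 hi)
  have hS : N.h ≤ ∑ i ∈ N.S, y i := by
    obtain ⟨t, ht⟩ := hT
    rw [← hp.sum_source ht]
    exact Finset.sum_le_sum (hxy t ht)
  obtain ⟨μ, hμ⟩ := exists_forall_entropy_eq N.S (g := fun U => min N.h (∑ i ∈ U, y i))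
    (by simpa using hp.h_nonneg hT)
  refine ⟨⟨p, fun t i => p.x t (none, some i), μ⟩, ⟨⟨hp, fun _ _ _ _ => le_rfl, fun t ht => ?_,
    fun i hi => ?_, ?_⟩, elementalInequalities_of_entropy_eq_min hμ hy hS⟩, rfl⟩
  · exact mem_slepianWolf_of_entropy_eq_min hμ
      (fun i hi => hp.x_nonneg ht (none_mem_Estar.2 hi)) (hxy t ht) (hp.sum_source ht)
  · rw [hμ _ (Finset.singleton_subset_iff.2 hi), Finset.sum_singleton, min_eq_right (hz i hi)]
  · rw [← entropy_self, hμ _ subset_rfl, min_eq_left hS]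

lemma coded_dominatedBy_atomCoded (hT : N.T.Nonempty) (hd : ∀ i ∈ N.S, 0 ≤ N.d i) :
    N.coded.DominatedBy N.atomCoded := by
  intro p (hp : N.FlowConstraints p)
  have hz : ∀ i ∈ N.S, (p.clamp N.edgeBound).z (none, some i) ≤ N.h := fun i _ =>
    (clampAbs_mem_Icc _ _).2.trans_eq (abs_of_nonneg (hp.h_nonneg hT))
  obtain ⟨q, hq, hqp⟩ := (hp.clamp hT).exists_mem_atomCoded_feasible hT hz
  have hcost : N.atomCoded.cost q = N.coded.cost (p.clamp N.edgeBound) :=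
    congrArg N.coded.cost hqp
  exact ⟨q, hq, hcost.trans_le (hp.coded_cost_clamp_le hT hd)⟩

variable (N) in
lemma atomCoded_dominatedBy_coded : N.atomCoded.DominatedBy N.coded :=
  fun q hq => ⟨q.toFlowPoint, hq.1.1, le_rfl⟩

variable (N) in
lemma atomStorageCost_eq_sum_entropy (μ : Finset V → ℝ) :
    N.atomStorageCost μ = ∑ i ∈ N.S, N.d i * entropy N.S μ {i} := by
  calc N.atomStorageCost μ
      = ∑ A ∈ atoms N.S, ∑ i ∈ N.S with A ∈ sourceSet N.S i, N.d i * μ A := by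
        simp only [atomStorageCost, Finset.sum_mul]
    _ = ∑ i ∈ N.S, ∑ A ∈ sourceSet N.S i, N.d i * μ A := by
        refine Finset.sum_comm' fun A i => ?_
        simp only [sourceSet, Finset.mem_filter]
        tauto
    _ = ∑ i ∈ N.S, N.d i * entropy N.S μ {i} := by
        simp only [entropy, unionSet_singleton, signedMeas, Finset.mul_sum]

variable (N) in
@[fun_prop]
lemma continuous_atomStorageCost : Continuous N.atomStorageCost := by
  unfold atomStorageCost
  fun_prop

lemma atomStorageCost_congr {ν : Finset V → ℝ} (h : ∀ A ∈ atoms N.S, μ A = ν A) :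
    N.atomStorageCost μ = N.atomStorageCost ν :=
  Finset.sum_congr rfl fun A hA => by rw [h A hA]

lemma clampAbs_eq_self_of_mem_atoms (h0 : ∀ A ∈ atoms N.S, 0 ≤ μ A)
    (hsum : signedMeas μ (atoms N.S) = N.h) : ∀ A ∈ atoms N.S, clampAbs N.h (μ A) = μ A :=
  fun A hA => clampAbs_eq_self (h0 A hA) ((le_signedMeas_atoms h0 hA).trans_eq hsum)

variable (N μ₁) in
lemma isClosed_gap_feasible : IsClosed (N.gap μ₁).feasible := by
  simp only [gap, condEntropy, Set.ofPred_and, Set.ofPred_forall]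
  refine .inter (isClosed_iInter fun U => isClosed_iInter fun _ => ?_)
    (.inter (isClosed_iInter fun A => isClosed_iInter fun _ => ?_) ?_)
  · exact isClosed_le (by fun_prop) (by fun_prop)
  · exact isClosed_le (by fun_prop) (by fun_prop)
  · exact isClosed_eq (by fun_prop) (by fun_prop)

lemma exists_isOptimal_gap (hne : (N.gap μ₁).feasible.Nonempty) :
    ∃ μ, (N.gap μ₁).IsOptimal μ := by
  refine MinProblem.exists_isOptimal_of_isCompact
    (isCompact_univ_pi fun _ => isCompact_Icc (a := 0) (b := |N.h|)) (N.isClosed_gap_feasible μ₁)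
    (N.continuous_atomStorageCost.sub continuous_const) (fun μ hμ => ?_) hne
  obtain ⟨hcond, h0, hsum⟩ := hμ
  have hclamp := clampAbs_eq_self_of_mem_atoms h0 hsum
  refine ⟨fun A => clampAbs N.h (μ A), ⟨fun A _ => clampAbs_mem_Icc _ _, fun U hU => ?_,
    fun A _ => (clampAbs_mem_Icc _ _).1, ?_⟩, ?_⟩
  · exact (signedMeas_congr hclamp Finset.sdiff_subset).trans_le (hcond U hU)
  · exact (signedMeas_congr hclamp subset_rfl).trans hsum
  · exact sub_le_sub_right (atomStorageCost_congr hclamp).le _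

lemma gap_feasible_nonempty (hh : 0 ≤ N.h) (hμ₁ : ∀ U ⊆ N.S, 0 ≤ condEntropy N.S μ₁ U)
    (hsum : signedMeas μ₁ (atoms N.S) = N.h) : (N.gap μ₁).feasible.Nonempty := by
  have hsingle : signedMeas (Pi.single N.S N.h) (atoms N.S) = N.h := by
    rw [signedMeas_single, ite_eq_left_iff]
    intro hS
    have : N.S = ∅ := by simpa [mem_atoms] using hS
    simp [← hsum, this, atoms, signedMeas]
  refine ⟨Pi.single N.S N.h, fun U hU => ?_, fun A _ => ?_, hsingle⟩
  · rcases hU.eq_or_ssubset with rfl | hssub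
    · rw [condEntropy_eq_signedMeas_atoms _ hU, hsingle, condEntropy_eq_signedMeas_atoms _ hU, hsum]
    · have hnotMem : N.S ∉ atoms U := fun h => hssub.not_subset (mem_atoms.1 h).2
      rw [condEntropy_eq_signedMeas_atoms _ hU, signedMeas_single, if_neg hnotMem]
      exact hμ₁ U hU
  · exact (Pi.single_nonneg (i := N.S).2 hh : 0 ≤ (Pi.single N.S N.h : Finset V → ℝ)) A

variable {q : AtomFlowPoint V}

lemma AtomConstraints.clamp (hq : N.AtomConstraints q) (hT : N.T.Nonempty)
    (h0 : ∀ A ∈ atoms N.S, 0 ≤ q.μ A) : N.AtomConstraints (q.clamp N.edgeBound N.h) := by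
  obtain ⟨hflow, hR, hSW, hz, hsum⟩ := hq
  have hμ := clampAbs_eq_self_of_mem_atoms h0 hsum.symm
  have hR_le : ∀ t ∈ N.T, ∀ i ∈ N.S, q.R t i ≤ N.h := fun t ht i hi =>
    (hR t ht i hi).trans (hflow.source_le ht hi)
  have hz_le : ∀ i ∈ N.S, q.z (none, some i) ≤ N.h := fun i hi => by
    rw [hz i hi, hsum]
    exact signedMeas_mono h0 (unionSet_subset _ _)
  refine ⟨hflow.clamp hT, fun t ht i hi => clampAbs_le_clampAbs _ (hR t ht i hi),
    fun t ht U hU => ?_, fun i hi => ?_, hsum.trans (signedMeas_congr hμ subset_rfl).symm⟩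
  · calc condEntropy N.S (q.clamp N.edgeBound N.h).μ U
        = condEntropy N.S q.μ U := signedMeas_congr hμ Finset.sdiff_subset
      _ ≤ ∑ i ∈ U, q.R t i := hSW t ht U hU
      _ ≤ ∑ i ∈ U, clampAbs N.h (q.R t i) :=
        Finset.sum_le_sum fun i hi => le_clampAbs (hR_le t ht i (hU hi))
  · calc clampAbs N.h (q.z (none, some i))
        = q.z (none, some i) :=
          clampAbs_eq_self (hflow.z_nonneg hT (none_mem_Estar.2 hi)) (hz_le i hi)
      _ = entropy N.S q.μ {i} := hz i hi
      _ = entropy N.S (q.clamp N.edgeBound N.h).μ {i} :=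
        (signedMeas_congr hμ (unionSet_subset _ _)).symm

variable (N) in
lemma isClosed_subset_feasible : IsClosed N.subset.feasible := by
  simp only [subset, AtomConstraints, slepianWolf, condEntropy, entropy, Set.mem_ofPred_eq]
  simp only [Set.ofPred_and, Set.ofPred_forall]
  refine .inter (.inter (N.isClosed_flowConstraints.preimage (by fun_prop))
    (.inter (isClosed_iInter fun t => isClosed_iInter fun _ => isClosed_iInter fun i =>
      isClosed_iInter fun _ => ?_)
    (.inter (isClosed_iInter fun t => isClosed_iInter fun _ => isClosed_iInter fun U =>
      isClosed_iInter fun _ => ?_)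
    (.inter (isClosed_iInter fun i => isClosed_iInter fun _ => ?_) ?_))))
    (isClosed_iInter fun A => isClosed_iInter fun _ => ?_)
  · exact isClosed_le (by fun_prop) (by fun_prop)
  · exact isClosed_le (by fun_prop) (by fun_prop)
  · exact isClosed_eq (by fun_prop) (by fun_prop)
  · exact isClosed_eq (by fun_prop) (by fun_prop)
  · exact isClosed_le (by fun_prop) (by fun_prop)

lemma exists_isOptimal_subset (hT : N.T.Nonempty) (hne : N.subset.feasible.Nonempty) :
    ∃ r, N.subset.IsOptimal r := by
  refine MinProblem.exists_isOptimal_of_isCompact (AtomFlowPoint.isCompact_box N.edgeBound N.h)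
    N.isClosed_subset_feasible ?_ (fun q ⟨hq, h0⟩ => ⟨q.clamp N.edgeBound N.h,
      ⟨q.clamp_mem_box _ _, hq.clamp hT h0, fun A _ => (clampAbs_mem_Icc _ _).1⟩, ?_⟩) hne
  · simp only [subset, edgeCost]
    fun_prop
  · exact (congrArg₂ (· + ·) (hq.1.edgeCost_clamp hT)
      (atomStorageCost_congr (clampAbs_eq_self_of_mem_atoms h0 hq.2.2.2.2.symm))).le

lemma AtomConstraints.withAtoms_mem_feasible (hq : N.AtomConstraints q)
    (hμ : μ ∈ (N.gap q.μ).feasible) : N.withAtoms q μ ∈ N.subset.feasible := by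
  obtain ⟨hflow, hR, hSW, hz, hsum⟩ := hq
  obtain ⟨hcond, h0, hμsum⟩ := hμ
  have hstorage : ∀ t ∈ N.T, ∀ i ∈ N.S, q.x t (none, some i) ≤ entropy N.S μ {i} := by
    intro t ht i hi
    calc q.x t (none, some i) ≤ q.z (none, some i) := hflow.x_le_z ht (none_mem_Estar.2 hi)
      _ = entropy N.S q.μ {i} := hz i hi
      _ ≤ entropy N.S μ {i} :=
        entropy_le_of_condEntropy_le hi (hμsum.trans hsum) (hcond _ (Finset.erase_subset _ _))
  exact ⟨⟨hflow.of_eqOn (fun _ _ _ _ => rfl) (fun _ _ => rfl) hstorage, hR,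
    fun t ht U hU => (hcond U hU).trans (hSW t ht U hU), fun _ _ => rfl, hμsum.symm⟩, h0⟩

lemma AtomConstraints.subset_cost_withAtoms (hq : N.AtomConstraints q) (μ : Finset V → ℝ) :
    N.subset.cost (N.withAtoms q μ) = N.atomCoded.cost q + (N.gap q.μ).cost μ := by
  have hstorage : N.storageCost q.toFlowPoint = N.atomStorageCost q.μ := by
    rw [atomStorageCost_eq_sum_entropy]
    exact Finset.sum_congr rfl fun i hi => by rw [hq.2.2.2.1 i hi]
  change N.edgeCost q.toFlowPoint + N.atomStorageCost μ =
    N.edgeCost q.toFlowPoint + N.storageCost q.toFlowPoint +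
      (N.atomStorageCost μ - N.atomStorageCost q.μ)
  rw [hstorage]
  ring

end MulticastInstance

theorem mainTheorem5_general {V : Type*} [DecidableEq V] (N : MulticastInstance V)
    (hT : N.T.Nonempty) (hd : ∀ i ∈ N.S, 0 ≤ N.d i) :
    (N.atomCoded.value = N.coded.value ∧
      (N.coded.feasible.Nonempty →
        ∃ p q, N.coded.IsOptimal p ∧ N.atomCoded.IsOptimal q ∧
          N.coded.cost p = N.atomCoded.cost q)) ∧
    ∀ q ∈ N.atomCoded.feasible,
      (∃ μ, (N.gap q.μ).IsOptimal μ) ∧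
      (∀ μ ∈ (N.gap q.μ).feasible,
        N.withAtoms q μ ∈ N.subset.feasible ∧
        N.subset.cost (N.withAtoms q μ) = N.atomCoded.cost q + (N.gap q.μ).cost μ) ∧
      (∃ r, N.subset.IsOptimal r) ∧
      ∀ r μ, N.subset.IsOptimal r → (N.gap q.μ).IsOptimal μ →
        N.subset.cost r - N.atomCoded.cost q ≤ (N.gap q.μ).cost μ := by
  have hto := MulticastInstance.coded_dominatedBy_atomCoded hT hd
  have hof := N.atomCoded_dominatedBy_coded
  refine ⟨⟨hto.value_le.antisymm hof.value_le, fun hne => ?_⟩, fun q ⟨hq, hel⟩ => ?_⟩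
  · obtain ⟨p, hp⟩ := MulticastInstance.exists_isOptimal_coded hT hd hne
    obtain ⟨q, hq, hpq⟩ := hto.exists_isOptimal_cost_eq hof hp
    exact ⟨p, q, hp, hq, hpq⟩
  · obtain ⟨μ₀, hμ₀⟩ := MulticastInstance.gap_feasible_nonempty (hq.1.h_nonneg hT)
      (fun U _ => hel.condEntropy_nonneg U) hq.2.2.2.2.symm
    refine ⟨MulticastInstance.exists_isOptimal_gap ⟨μ₀, hμ₀⟩,
      fun μ hμ => ⟨hq.withAtoms_mem_feasible hμ, hq.subset_cost_withAtoms μ⟩,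
      MulticastInstance.exists_isOptimal_subset hT ⟨_, hq.withAtoms_mem_feasible hμ₀⟩,
      fun r μ hr hμ => ?_⟩
    rw [sub_le_iff_le_add', ← hq.subset_cost_withAtoms μ]
    exact hr.2 _ (hq.withAtoms_mem_feasible hμ.1)

theorem mainTheorem5 {V : Type*} [Fintype V] [DecidableEq V] (N : MulticastInstance V)
    (hT : N.T.Nonempty) (hd : ∀ i ∈ N.S, 0 ≤ N.d i) :
    -- the two coded problems have the same optimum, attained as soon as there is a feasible point
    (N.atomCoded.value = N.coded.value ∧
      (N.coded.feasible.Nonempty →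
        ∃ p q, N.coded.IsOptimal p ∧ N.atomCoded.IsOptimal q ∧
          N.coded.cost p = N.atomCoded.cost q)) ∧
    -- for every optimal solution of the atom version:
    ∀ q, N.atomCoded.IsOptimal q →
      -- the gap LP has an optimal solution,
      (∃ μ, (N.gap q.μ).IsOptimal μ) ∧
      -- its feasible points give feasible subset solutions with the same flows,
      (∀ μ ∈ (N.gap q.μ).feasible,
        N.withAtoms q μ ∈ N.subset.feasible ∧
        N.subset.cost (N.withAtoms q μ) = N.atomCoded.cost q + (N.gap q.μ).cost μ) ∧
      -- and its optimal value bounds the gap between the subset and the coded optimum.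
      (∃ r, N.subset.IsOptimal r) ∧
      ∀ p r μ, N.coded.IsOptimal p → N.subset.IsOptimal r → (N.gap q.μ).IsOptimal μ →
        N.subset.cost r - N.coded.cost p ≤ (N.gap q.μ).cost μ := by
  have ⟨hcoded, hgap⟩ := mainTheorem5_general N hT hd
  exact ⟨hcoded, fun q hq => (hgap q hq.1).imp_right <| And.imp_right <| And.imp_right fun hle p r μ
    hp => hp.cost_eq_of_value_eq hq hcoded.1.symm ▸ hle r μ⟩
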